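/- Let $S$ be the Thue–Morse substitution $S(0)=01$, $S(1)=10$ on the alphabet $\{0,1\}$, let $u=01101001\ldots$ be the one-sided sequence obtained by iterating $S$ on $0$, and let $\Omega_{\rm tm}$ be the set of all two-sided sequences $\omega\in\{0,1\}^{\mathbb Z}$ all of whose finite subwords occur in $u$. For $\lambda\in\mathbb R$ and $\omega\in\Omega_{\rm tm}$ let $H=H_{\lambda,\omega}$ be the operator on $\ell^2(\mathbb Z)$ given by $$(H\psi)(n)=\psi(n-1)+\psi(n+1)+\lambda\,\omega_n\,\psi(n).$$ For $p>0$ and $T>0$ put $$a(n,T)=\frac1T\int_0^\infty e^{-2t/T}\,\bigl|\langle \delta_n, e^{-itH}\delta_1\rangle\bigr|^2\,dt,\qquad \langle |X|^p\rangle(T)=\sum_{n\in\mathbb Z}|n|^p\,a(n,T),$$ $$\beta^-(p)=\liminf_{T\to+\infty}\frac{\log\,\langle |X|^p\rangle(T)}{\log T}.$$ Then for every $\lambda\in\mathbb R$, every $\omega\in\Omega_{\rm tm}$ and every $p>0$, $$\beta^-(p)\ge p-1.$$ -/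

import Mathlib

open scoped ENNReal

noncomputable section

namespace ThueMorse

/-! ## The Thue–Morse sequence and subshift -/

/-- The Thue–Morse substitution on letters: `0 ↦ 01`, `1 ↦ 10`. -/
def substLetter (a : Fin 2) : List (Fin 2) :=
  if a = 0 then [0, 1] else [1, 0]

/-- The Thue–Morse substitution, extended to finite words by concatenation. -/
def substWord (w : List (Fin 2)) : List (Fin 2) :=
  w.flatMap substLetter

/-- The word `S^k(0)`. -/
def word (k : ℕ) : List (Fin 2) :=
  substWord^[k] [0]

/-- The one-sided Thue–Morse sequence `u = 01101001…` obtained by iterating the substitution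
on `0`. The word `S^n(0)` has length `2 ^ n > n` and each `S^k(0)` is a prefix of `S^(k+1)(0)`,
so the letter of `u` at position `n` can be read off from `S^n(0)`
(see `word_getElem_eq_u`; the default value of `getD` is never used). -/
def u (n : ℕ) : Fin 2 :=
  (word n).getD n 0

lemma length_substWord (w : List (Fin 2)) : (substWord w).length = 2 * w.length := by
  induction w with
  | nil => rfl
  | cons a w ih =>
    have h : (substLetter a).length = 2 := by
      unfold substLetter; split_ifs <;> rfl
    simp only [substWord, List.flatMap_cons, List.length_append, List.length_cons] at ih ⊢
    omega

lemma word_succ (k : ℕ) : word (k + 1) = substWord (word k) :=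
  Function.iterate_succ_apply' _ _ _

lemma length_word (k : ℕ) : (word k).length = 2 ^ k := by
  induction k with
  | zero => rfl
  | succ k ih => rw [word_succ, length_substWord, ih, pow_succ, mul_comm]

lemma word_prefix_succ (k : ℕ) : word k <+: word (k + 1) := by
  induction k with
  | zero => exact ⟨[1], rfl⟩
  | succ k ih =>
    obtain ⟨t, ht⟩ := ih
    refine ⟨substWord t, ?_⟩
    rw [word_succ (k + 1), word_succ k, ← word_succ k, ← ht]
    conv_lhs => rw [ht, word_succ k]
    simp [substWord, List.flatMap_append]

lemma word_prefix {k l : ℕ} (h : k ≤ l) : word k <+: word l := by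
  induction l, h using Nat.le_induction with
  | base => exact List.prefix_refl _
  | succ l _ ih => exact ih.trans (word_prefix_succ l)

/-- Every word `S^k(0)` is the prefix of length `2 ^ k` of the sequence `u`. -/
lemma word_getElem_eq_u (k n : ℕ) (h : n < (word k).length) : (word k)[n] = u n := by
  have hn : n < (word n).length := by rw [length_word]; exact Nat.lt_two_pow_self
  have e : u n = (word n)[n] := by simp [u, hn]
  rw [e]
  rcases le_total k n with hkn | hkn
  · exact (word_prefix hkn).getElem h
  · exact ((word_prefix hkn).getElem hn).symm

/-- The two-sided Thue–Morse subshift: all two-sided sequences over `{0, 1}` all of whose finite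
subwords `ω_m ω_{m+1} … ω_{m+l-1}` occur in `u`. -/
def subshift : Set (ℤ → Fin 2) :=
  {ω | ∀ (m : ℤ) (l : ℕ), ∃ j : ℕ, ∀ i : ℕ, i < l → ω (m + i) = u (j + i)}

/-- The potential `V(n) = lam * ω_n`, with `ω_n ∈ {0, 1}`. -/
def potential (lam : ℝ) (ω : ℤ → Fin 2) (n : ℤ) : ℝ :=
  lam * ((ω n : ℕ) : ℝ)

lemma bddAbove_potential (lam : ℝ) (ω : ℤ → Fin 2) :
    BddAbove (Set.range fun n => |potential lam ω n|) := by
  refine ⟨|lam|, ?_⟩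
  rintro _ ⟨n, rfl⟩
  have h1 : (((ω n : Fin 2) : ℕ) : ℝ) ≤ 1 := by
    have := (ω n).isLt
    exact_mod_cast Nat.le_of_lt_succ this
  have h0 : (0 : ℝ) ≤ (((ω n : Fin 2) : ℕ) : ℝ) := Nat.cast_nonneg _
  simp only [potential, abs_mul, abs_of_nonneg h0]
  exact mul_le_of_le_one_right (abs_nonneg _) h1

end ThueMorse

namespace DiscreteSchrodinger

/-! ## Discrete Schrödinger operators on `ℓ²(ℤ)` -/

/-- The Hilbert space `ℓ²(ℤ)` of square-summable functions `ℤ → ℂ`. -/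
abbrev H2 : Type := lp (fun _ : ℤ => ℂ) 2

/-- The basis vector `δ_m`. -/
def delta (m : ℤ) : H2 := lp.single 2 m (1 : ℂ)

lemma memlp_shift (k : ℤ) (ψ : H2) : Memℓp (fun n : ℤ => (ψ (n + k) : ℂ)) 2 := by
  have hp : (0 : ℝ) < (2 : ℝ≥0∞).toReal := by norm_num
  have h := (memℓp_gen_iff hp).1 (lp.memℓp ψ)
  exact (memℓp_gen_iff hp).2 (h.comp_injective (add_left_injective k))

/-- The translation `(ψ(n))_n ↦ (ψ(n + k))_n` on `ℓ²(ℤ)`. -/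
def shift (k : ℤ) : H2 →L[ℂ] H2 :=
  LinearMap.mkContinuous
    { toFun := fun ψ => ⟨fun n : ℤ => ψ (n + k), memlp_shift k ψ⟩
      map_add' := fun _ _ => rfl
      map_smul' := fun _ _ => rfl } 1 (by
    intro ψ
    have hp : (0 : ℝ) < (2 : ℝ≥0∞).toReal := by norm_num
    rw [one_mul, lp.norm_eq_tsum_rpow hp, lp.norm_eq_tsum_rpow hp ψ]
    refine le_of_eq ?_
    congr 1
    exact (Equiv.addRight k).tsum_eq (fun n : ℤ => ‖(ψ n : ℂ)‖ ^ (2 : ℝ≥0∞).toReal))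

lemma norm_mul_le {V : ℤ → ℝ} {C : ℝ} (hC : ∀ n, |V n| ≤ C) (ψ : H2) (n : ℤ) :
    ‖(V n : ℂ) * ψ n‖ ≤ ‖((C : ℂ) • ψ : H2) n‖ := by
  have hC0 : 0 ≤ C := (abs_nonneg _).trans (hC 0)
  rw [lp.coeFn_smul, Pi.smul_apply, smul_eq_mul, norm_mul, norm_mul, Complex.norm_real,
    Complex.norm_real, Real.norm_eq_abs, Real.norm_eq_abs, abs_of_nonneg hC0]
  exact mul_le_mul_of_nonneg_right (hC n) (norm_nonneg _)

lemma memlp_mul {V : ℤ → ℝ} (hV : BddAbove (Set.range fun n => |V n|)) (ψ : H2) :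
    Memℓp (fun n : ℤ => (V n : ℂ) * ψ n) 2 := by
  obtain ⟨C, hC⟩ := hV
  have hp : (0 : ℝ) < (2 : ℝ≥0∞).toReal := by norm_num
  have hC' : ∀ n, |V n| ≤ C := fun n => hC ⟨n, rfl⟩
  have h := (memℓp_gen_iff hp).1 (lp.memℓp ((C : ℂ) • ψ : H2))
  refine (memℓp_gen_iff hp).2 (h.of_nonneg_of_le (fun n => by positivity) fun n => ?_)
  exact Real.rpow_le_rpow (norm_nonneg _) (norm_mul_le hC' ψ n) hp.le

/-- Multiplication by a bounded real potential `V` on `ℓ²(ℤ)`. -/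
def mulPotential (V : ℤ → ℝ) (hV : BddAbove (Set.range fun n => |V n|)) : H2 →L[ℂ] H2 :=
  LinearMap.mkContinuousOfExistsBound
    { toFun := fun ψ => ⟨fun n : ℤ => (V n : ℂ) * ψ n, memlp_mul hV ψ⟩
      map_add' := fun ψ φ => by
        ext n
        exact mul_add _ _ _
      map_smul' := fun c ψ => by
        ext n
        exact mul_left_comm _ _ _ } (by
    obtain ⟨C, hC⟩ := id hV
    have hC' : ∀ n, |V n| ≤ C := fun n => hC ⟨n, rfl⟩
    refine ⟨C, fun ψ => ?_⟩
    have hC0 : 0 ≤ C := (abs_nonneg _).trans (hC' 0)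
    have h := lp.norm_mono (p := 2) (by norm_num)
      (x := (⟨fun n : ℤ => (V n : ℂ) * ψ n, memlp_mul hV ψ⟩ : H2))
      (y := ((C : ℂ) • ψ : H2)) (norm_mul_le hC' ψ)
    rwa [norm_smul, Complex.norm_real, Real.norm_eq_abs, abs_of_nonneg hC0] at h)

/-- The discrete Schrödinger operator `(Hψ)(n) = ψ(n-1) + ψ(n+1) + V(n)ψ(n)` on `ℓ²(ℤ)` with a
bounded real potential `V`. -/
def hamiltonian (V : ℤ → ℝ) (hV : BddAbove (Set.range fun n => |V n|)) : H2 →L[ℂ] H2 :=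
  shift (-1) + shift 1 + mulPotential V hV

lemma hamiltonian_apply (V : ℤ → ℝ) (hV : BddAbove (Set.range fun n => |V n|)) (ψ : H2) (n : ℤ) :
    hamiltonian V hV ψ n = ψ (n - 1) + ψ (n + 1) + (V n : ℂ) * ψ n :=
  rfl

/-- The time evolution `exp(-itH) ψ`. -/
def evolve (H : H2 →L[ℂ] H2) (t : ℝ) (ψ : H2) : H2 :=
  NormedSpace.exp ((-(Complex.I * (t : ℂ))) • H) ψ

/-- The time-averaged probability
`a(n,T) = (1/T) ∫_0^∞ e^{-2t/T} |(e^{-itH} δ_1)(n)|² dt`, as an extended nonnegative number. -/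
def timeAvgProb (H : H2 →L[ℂ] H2) (n : ℤ) (T : ℝ) : ℝ≥0∞ :=
  ENNReal.ofReal (1 / T) *
    ∫⁻ t in Set.Ioi (0 : ℝ),
      ENNReal.ofReal (Real.exp (-2 * t / T) * ‖evolve H t (delta 1) n‖ ^ 2)

/-- The time-averaged `p`-th moment `∑_n |n|^p a(n,T)` of the position operator for the initial
state `δ_1`. -/
def moment (H : H2 →L[ℂ] H2) (p T : ℝ) : ℝ≥0∞ :=
  ∑' n : ℤ, ENNReal.ofReal (|(n : ℝ)| ^ p) * timeAvgProb H n T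

/-- The lower growth exponent
`β⁻(p) = liminf_{T → ∞} log (∑_n |n|^p a(n,T)) / log T`, as an extended real number. -/
def betaMinus (H : H2 →L[ℂ] H2) (p : ℝ) : EReal :=
  Filter.liminf (fun T : ℝ => ENNReal.log (moment H p T) / ((Real.log T : ℝ) : EReal))
    Filter.atTop

end DiscreteSchrodinger

end


/-
Let `E` satisfy `E (E - λ) = 2` and let `A`, `B` be the one-step transfer matrices of the letters
`0`, `1` at energy `E`. The product `B A` has determinant `1` and trace `E (E - λ) - 2 = 0`, so
`(B A)² = -1` and likewise `(A B)² = -1`. Hence the blocks `S³(0) = 01101001` and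
`S³(1) = 10010110` have trivial transfer matrix, and all solutions at energy `E` are bounded,
uniformly over the subshift.

The Green function `G(n) = ⟨δ_n, (H - z)⁻¹ δ_1⟩` at `z = E + 2i/T` solves the difference equation
away from the source, and cannot be small next to the source. Its Wronskians with the solutions at
energy `E` change at the site `n` by at most a constant times `|z - E| |G(n)|`, where `|z - E|` is
`2/T`, so by Gronwall's inequality `G` stays bounded below (up to passing to one of two adjacent
sites) out to distance `T` on one side. As `G` is the Laplace transform of the evolution, the
Cauchy–Schwarz inequality gives `a(n, T) ≥ 2 |G(n)|² / T²`. Summing `|n|^p a(n, T)` over the order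
of `T` sites at distance of order `T` yields a moment of order at least `T · T^p · T⁻²`.
-/

theorem le_mul_exp_of_le_add_sum {u : ℕ → ℝ} {B δ : ℝ} {N : ℕ} (hB : 0 ≤ B) (hδ : 0 ≤ δ)
    (h : ∀ k ≤ N, u k ≤ B + δ * ∑ l ∈ Finset.range k, u l) :
    u N ≤ B * Real.exp (N * δ) := by
  have hsum : ∀ k ≤ N, B + δ * ∑ l ∈ Finset.range k, u l ≤ B * (1 + δ) ^ k := by
    intro k
    induction k with
    | zero => simp
    | succ k ih =>
      intro hk
      have hstep := mul_le_mul_of_nonneg_left (h k (by omega)) hδ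
      have hprev := mul_le_mul_of_nonneg_right (ih (by omega)) (by linarith : 0 ≤ 1 + δ)
      rw [Finset.sum_range_succ, pow_succ]
      linarith
  have hexp : (1 + δ) ^ N ≤ Real.exp (N * δ) := by
    rw [Real.exp_nat_mul, add_comm]
    exact pow_le_pow_left₀ (by positivity) (Real.add_one_le_exp δ) N
  exact (h N le_rfl).trans ((hsum N le_rfl).trans (mul_le_mul_of_nonneg_left hexp hB))

theorem exists_int_orbit {X : Type*} (e : ℤ → X ≃ X) (m : ℤ) (x : X) :
    ∃ v : ℤ → X, v m = x ∧ ∀ i, v (i + 1) = e i (v i) := by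
  refine ⟨fun i => i.inductionOn' m x (fun k _ y => e k y) (fun k _ y => (e (k - 1)).symm y),
    Int.inductionOn'_self, fun i => ?_⟩
  rcases le_or_gt m i with hi | hi
  · exact Int.inductionOn'_add_one hi
  · have h := Int.inductionOn'_sub_one (motive := fun _ => X) (zero := x)
      (succ := fun k _ y => e k y) (pred := fun k _ y => (e (k - 1)).symm y) (z := i + 1)
      (b := m) (by omega)
    rw [← Equiv.symm_apply_eq, eq_comm]
    simpa only [add_sub_cancel_right] using h

open MeasureTheory in
theorem sq_lintegral_mul_le {α : Type*} [MeasurableSpace α] {μ : Measure α} {w f : α → ℝ≥0∞}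
    (hw : AEMeasurable w μ) (hf : AEMeasurable f μ) :
    (∫⁻ a, w a * f a ∂μ) ^ 2 ≤ (∫⁻ a, w a ∂μ) * ∫⁻ a, w a * f a ^ 2 ∂μ := by
  have hsqrt : ∀ x : ℝ≥0∞, (x ^ (1 / 2 : ℝ)) ^ 2 = x := fun x => by
    rw [← ENNReal.rpow_natCast, ← ENNReal.rpow_mul]
    norm_num
  have hprod : ∀ a, w a ^ (1 / 2 : ℝ) * (w a * f a ^ 2) ^ (1 / 2 : ℝ) = w a * f a := fun a => by
    rw [← ENNReal.mul_rpow_of_nonneg _ _ (by norm_num), ← mul_assoc, ← sq, ← mul_pow,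
      ← ENNReal.rpow_natCast, ← ENNReal.rpow_mul]
    norm_num
  have hHolder := ENNReal.lintegral_mul_norm_pow_le hw (hw.mul (hf.pow_const 2))
    (p := 1 / 2) (q := 1 / 2) (by norm_num) (by norm_num) (by norm_num)
  calc (∫⁻ a, w a * f a ∂μ) ^ 2
      = (∫⁻ a, w a ^ (1 / 2 : ℝ) * (w a * f a ^ 2) ^ (1 / 2 : ℝ) ∂μ) ^ 2 := by simp only [hprod]
    _ ≤ ((∫⁻ a, w a ∂μ) ^ (1 / 2 : ℝ) * (∫⁻ a, w a * f a ^ 2 ∂μ) ^ (1 / 2 : ℝ)) ^ 2 :=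
        pow_le_pow_left' hHolder 2
    _ = (∫⁻ a, w a ∂μ) * ∫⁻ a, w a * f a ^ 2 ∂μ := by rw [mul_pow, hsqrt, hsqrt]

theorem sum_add_shift_le_two_mul_tsum {G : Type*} [AddGroup G] (F : G → ℝ≥0∞) (d : G)
    (S : Finset G) : ∑ n ∈ S, (F n + F (n + d)) ≤ 2 * ∑' n, F n :=
  calc ∑ n ∈ S, (F n + F (n + d)) = ∑ n ∈ S, F n + ∑ n ∈ S, F (n + d) := Finset.sum_add_distrib
    _ ≤ ∑' n, F n + ∑' n, F (n + d) :=
        add_le_add (ENNReal.sum_le_tsum S) (ENNReal.sum_le_tsum S)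
    _ = 2 * ∑' n, F n := by
      rw [two_mul]
      exact congrArg (_ + ·) ((Equiv.addRight d).tsum_eq F)

namespace DiscreteSchrodinger

section Transfer

/-- The transfer map of the recursion `x (n + 1) = q * x n - x (n - 1)`, acting on pairs of
consecutive values `(x (n - 1), x n)`. -/
def transfer {R : Type*} [CommRing R] (q : R) : (R × R) ≃ₗ[R] R × R where
  toFun v := (v.2, q * v.2 - v.1)
  invFun v := (q * v.1 - v.2, v.1)
  map_add' v w := by ext <;> simp; ring
  map_smul' c v := by ext <;> simp; ring
  left_inv v := by ext <;> simp
  right_inv v := by ext <;> simp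

/-- The composition of the first `n` transfer maps along a coefficient sequence `q`, with the map
of `q 0` applied first. -/
def transferProd {R : Type*} [CommRing R] (q : ℕ → R) : ℕ → (R × R) ≃ₗ[R] R × R
  | 0 => LinearEquiv.refl R (R × R)
  | n + 1 => (transferProd q n).trans (transfer (q n))

section CommRing

variable {R : Type*} [CommRing R]

lemma transfer_apply (q : R) (v : R × R) : transfer q v = (v.2, q * v.2 - v.1) :=
  rfl

lemma transfer_swap_transfer (q : R) (v : R × R) : transfer q (transfer q v).swap = v.swap := by
  ext <;> simp [transfer_apply]

lemma transferProd_succ_apply (q : ℕ → R) (n : ℕ) (v : R × R) :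
    transferProd q (n + 1) v = transfer (q n) (transferProd q n v) :=
  rfl

-- The composition of the two transfer maps has determinant `1` and trace `a * b - 2 = 0`, so this
-- is the Cayley–Hamilton theorem.
lemma transfer_transfer_sq {a b : R} (h : a * b = 2) (v : R × R) :
    transfer b (transfer a (transfer b (transfer a v))) = -v := by
  ext
  · simp only [transfer_apply, Prod.fst_neg]
    linear_combination (a * v.2 - v.1) * h
  · simp only [transfer_apply, Prod.snd_neg]
    linear_combination (a * b * v.2 - v.2 - b * v.1) * h

lemma transfer_block {a b : R} (h : a * b = 2) (v : R × R) :
    transfer b (transfer a (transfer a (transfer b (transfer a (transfer b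
      (transfer b (transfer a v))))))) = v := by
  rw [transfer_transfer_sq (mul_comm b a ▸ h), map_neg, map_neg, transfer_transfer_sq h, neg_neg]

lemma eq_transferProd_of_step {q : ℕ → R} {w : ℕ → R × R} {j l : ℕ}
    (h : ∀ i < l, w (i + 1) = transfer (q (j + i)) (w i)) :
    w l = transferProd q (j + l) ((transferProd q j).symm (w 0)) := by
  induction l with
  | zero => simp
  | succ l ih =>
    rw [h l l.lt_succ_self, ih fun i hi => h i (by omega), ← add_assoc, transferProd_succ_apply]

end CommRing

section Normed

variable {R : Type*} [NormedCommRing R]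

lemma norm_transfer_le (q : R) (v : R × R) : ‖transfer q v‖ ≤ (‖q‖ + 1) * ‖v‖ := by
  have h1 := norm_fst_le v
  have h2 := norm_snd_le v
  have hq : ‖q * v.2‖ ≤ ‖q‖ * ‖v‖ := (_root_.norm_mul_le _ _).trans (by gcongr)
  refine max_le (h2.trans (le_mul_of_one_le_left (norm_nonneg v) (by simp))) ?_
  change ‖q * v.2 - v.1‖ ≤ _
  linarith [norm_sub_le (q * v.2) v.1]

lemma norm_swap (v : R × R) : ‖v.swap‖ = ‖v‖ :=
  max_comm _ _

lemma norm_le_norm_transfer (q : R) (v : R × R) : ‖v‖ ≤ (‖q‖ + 1) * ‖transfer q v‖ := by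
  rw [← norm_swap v, ← norm_swap (transfer q v), ← transfer_swap_transfer q v]
  exact norm_transfer_le q _

variable {q : ℕ → R} {L : ℝ}

lemma norm_transferProd_add_le (hL : ∀ i, ‖q i‖ + 1 ≤ L) (m d : ℕ) (v : R × R) :
    ‖transferProd q (m + d) v‖ ≤ L ^ d * ‖transferProd q m v‖ := by
  have hL0 : 0 ≤ L := le_trans (by positivity) (hL 0)
  induction d with
  | zero => simp
  | succ d ih =>
    calc ‖transferProd q (m + (d + 1)) v‖
        ≤ (‖q (m + d)‖ + 1) * ‖transferProd q (m + d) v‖ := norm_transfer_le _ _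
      _ ≤ L * (L ^ d * ‖transferProd q m v‖) := by gcongr; exact hL _
      _ = L ^ (d + 1) * ‖transferProd q m v‖ := by ring

lemma norm_transferProd_le_add (hL : ∀ i, ‖q i‖ + 1 ≤ L) (m d : ℕ) (v : R × R) :
    ‖transferProd q m v‖ ≤ L ^ d * ‖transferProd q (m + d) v‖ := by
  have hL0 : 0 ≤ L := le_trans (by positivity) (hL 0)
  induction d with
  | zero => simp
  | succ d ih =>
    calc ‖transferProd q m v‖ ≤ L ^ d * ‖transferProd q (m + d) v‖ := ih
      _ ≤ L ^ d * ((‖q (m + d)‖ + 1) * ‖transferProd q (m + (d + 1)) v‖) := by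
          gcongr; exact norm_le_norm_transfer _ _
      _ ≤ L ^ d * (L * ‖transferProd q (m + (d + 1)) v‖) := by gcongr; exact hL _
      _ = L ^ (d + 1) * ‖transferProd q (m + (d + 1)) v‖ := by ring

variable {N : ℕ}

lemma norm_transferProd_le_of_periodic (hL : ∀ i, ‖q i‖ + 1 ≤ L) (hN : 0 < N)
    (hq : ∀ k v, transferProd q (N * k) v = v) (m n : ℕ) (v : R × R) :
    ‖transferProd q n v‖ ≤ L ^ N * L ^ N * ‖transferProd q m v‖ := by
  have hL1 : 1 ≤ L := le_trans (by simp) (hL 0)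
  have hmod : ∀ i, i % N ≤ N := fun i => (Nat.mod_lt i hN).le
  have hup := norm_transferProd_add_le hL (N * (n / N)) (n % N) v
  have hdown := norm_transferProd_le_add hL (N * (m / N)) (m % N) v
  rw [Nat.div_add_mod, hq] at hup hdown
  calc ‖transferProd q n v‖ ≤ L ^ N * ‖v‖ := hup.trans (by gcongr; exact hmod n)
    _ ≤ L ^ N * (L ^ N * ‖transferProd q m v‖) := by
        gcongr
        exact hdown.trans (by gcongr; exact hmod m)
    _ = L ^ N * L ^ N * ‖transferProd q m v‖ := (mul_assoc _ _ _).symm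

end Normed

end Transfer

section Solutions

/-- The difference equation `ψ (i + 1) + ψ (i - 1) + V i ψ i = z ψ i` at a single site `i`. -/
def SolvesAt (V : ℤ → ℝ) (z : ℂ) (ψ : ℤ → ℂ) (i : ℤ) : Prop :=
  ψ (i + 1) + ψ (i - 1) + V i * ψ i = z * ψ i

/-- The pair of consecutive values that determines a solution of the difference equation. The norm
on `ℂ × ℂ` is the maximum norm. -/
def cauchyData (ψ : ℤ → ℂ) (n : ℤ) : ℂ × ℂ :=
  (ψ n, ψ (n + 1))

/-- The Wronskian of two sequences. It is constant when both solve the difference equation at the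
same energy, and serves to compare solutions at nearby energies. -/
def wronskian (ψ φ : ℤ → ℂ) (n : ℤ) : ℂ :=
  ψ (n + 1) * φ n - ψ n * φ (n + 1)

/-- All solutions at energy `E` are bounded by `K` times their Cauchy data at any site: the
transfer matrices between any two sites are uniformly bounded. -/
def HasBoundedSolutions (V : ℤ → ℝ) (E : ℂ) (K : ℝ) : Prop :=
  ∀ φ : ℤ → ℂ, (∀ i, SolvesAt V E φ i) → ∀ m n, ‖cauchyData φ n‖ ≤ K * ‖cauchyData φ m‖

variable {V : ℤ → ℝ} {z E : ℂ} {ψ φ : ℤ → ℂ} {K : ℝ}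

lemma solvesAt_add_one_iff {n : ℤ} :
    SolvesAt V z ψ (n + 1) ↔
      cauchyData ψ (n + 1) = transfer (z - V (n + 1)) (cauchyData ψ n) := by
  simp only [SolvesAt, cauchyData, transfer_apply, Prod.mk.injEq, true_and, add_sub_cancel_right]
  constructor <;> intro h <;> linear_combination h

lemma exists_solution (V : ℤ → ℝ) (E : ℂ) (m : ℤ) (v : ℂ × ℂ) :
    ∃ φ : ℤ → ℂ, cauchyData φ m = v ∧ ∀ i, SolvesAt V E φ i := by
  obtain ⟨w, hw, hstep⟩ := exists_int_orbit (fun i => (transfer (E - V (i + 1))).toEquiv) m v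
  have hdata : ∀ i, cauchyData (fun j => (w j).1) i = w i := fun i =>
    Prod.ext rfl (congrArg Prod.fst (hstep i))
  refine ⟨fun i => (w i).1, (hdata m).trans hw, fun i => ?_⟩
  rw [← sub_add_cancel i 1, solvesAt_add_one_iff, hdata, hdata]
  exact hstep (i - 1)

lemma SolvesAt.comp_neg {i : ℤ} (h : SolvesAt V z ψ (-i)) :
    SolvesAt (fun j => V (-j)) z (fun j => ψ (-j)) i := by
  simp only [SolvesAt, neg_add', neg_sub', sub_neg_eq_add] at h ⊢
  linear_combination h

lemma norm_cauchyData_comp_neg (ψ : ℤ → ℂ) (n : ℤ) :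
    ‖cauchyData (fun j => ψ (-j)) n‖ = ‖cauchyData ψ (-n - 1)‖ := by
  rw [← norm_swap]
  simp only [cauchyData, Prod.swap_prod_mk, neg_add', sub_add_cancel]

lemma HasBoundedSolutions.comp_neg (h : HasBoundedSolutions V E K) :
    HasBoundedSolutions (fun j => V (-j)) E K := by
  intro φ hφ m n
  have hsol : ∀ i, SolvesAt V E (fun j => φ (-j)) i := fun i => by
    simpa only [neg_neg] using (hφ (-i)).comp_neg
  have hrefl : ∀ i, ‖cauchyData (fun j => φ (-j)) (-i - 1)‖ = ‖cauchyData φ i‖ := fun i => by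
    rw [norm_cauchyData_comp_neg, show -(-i - 1) - 1 = i by ring]
  simpa only [hrefl] using h _ hsol (-m - 1) (-n - 1)

lemma HasBoundedSolutions.one_le (h : HasBoundedSolutions V E K) : 1 ≤ K := by
  obtain ⟨φ, hdata, hφ⟩ := exists_solution V E 0 (0, 1)
  simpa [hdata] using h φ hφ 0 0

lemma wronskian_sub_one {i : ℤ} (hψ : SolvesAt V z ψ i) (hφ : SolvesAt V E φ i) :
    wronskian ψ φ (i - 1) = wronskian ψ φ i - (z - E) * φ i * ψ i := by
  simp only [SolvesAt, wronskian, sub_add_cancel] at hψ hφ ⊢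
  linear_combination ψ i * hφ - φ i * hψ

lemma norm_wronskian_le (ψ φ : ℤ → ℂ) (n : ℤ) :
    ‖wronskian ψ φ n‖ ≤ 2 * ‖cauchyData φ n‖ * ‖cauchyData ψ n‖ := by
  have h1 := mul_le_mul (norm_snd_le (cauchyData ψ n)) (norm_fst_le (cauchyData φ n))
    (norm_nonneg _) (norm_nonneg _)
  have h2 := mul_le_mul (norm_fst_le (cauchyData ψ n)) (norm_snd_le (cauchyData φ n))
    (norm_nonneg _) (norm_nonneg _)
  have h := norm_sub_le (ψ (n + 1) * φ n) (ψ n * φ (n + 1))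
  rw [norm_mul, norm_mul] at h
  simp only [cauchyData] at h1 h2
  simp only [wronskian, cauchyData]
  linarith

lemma norm_cauchyData_le_of_wronskian {m : ℤ} {B : ℝ}
    (h : ∀ φ, (∀ i, SolvesAt V E φ i) → ‖cauchyData φ m‖ ≤ 1 → ‖wronskian ψ φ m‖ ≤ B) :
    ‖cauchyData ψ m‖ ≤ B := by
  have hdata : ∀ v : ℂ × ℂ, ‖v‖ ≤ 1 → ‖ψ (m + 1) * v.1 - ψ m * v.2‖ ≤ B := by
    rintro v hv
    obtain ⟨φ, rfl, hφ⟩ := exists_solution V E m v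
    exact h φ hφ hv
  refine max_le ?_ ?_
  · change ‖ψ m‖ ≤ B
    simpa using hdata (0, 1) (by simp)
  · change ‖ψ (m + 1)‖ ≤ B
    simpa using hdata (1, 0) (by simp)

lemma norm_wronskian_sub_le {n : ℤ} {k : ℕ} (hψ : ∀ i, n - k < i → i ≤ n → SolvesAt V z ψ i)
    (hφ : ∀ i, SolvesAt V E φ i) (hK : ∀ i, ‖cauchyData φ i‖ ≤ K) :
    ‖wronskian ψ φ (n - k)‖ ≤ 2 * K * ‖cauchyData ψ n‖ +
      ‖z - E‖ * K * ∑ l ∈ Finset.range k, ‖cauchyData ψ (n - l)‖ := by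
  have hK0 : 0 ≤ K := (norm_nonneg _).trans (hK 0)
  induction k with
  | zero =>
    simpa using (norm_wronskian_le ψ φ n).trans (by gcongr; exact hK n)
  | succ k ih =>
    have hprev := ih fun i hi => hψ i (by omega)
    have hsite : ‖(z - E) * φ (n - k) * ψ (n - k)‖ ≤ ‖z - E‖ * K * ‖cauchyData ψ (n - k)‖ := by
      have h1 : ‖φ (n - k)‖ ≤ K := (norm_fst_le (cauchyData φ (n - k))).trans (hK _)
      have h2 : ‖ψ (n - k)‖ ≤ ‖cauchyData ψ (n - k)‖ := norm_fst_le (cauchyData ψ (n - k))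
      rw [norm_mul, norm_mul]
      gcongr
    rw [show n - ((k + 1 : ℕ) : ℤ) = n - k - 1 by push_cast; ring,
      wronskian_sub_one (hψ (n - k) (by omega) (by omega)) (hφ (n - k)), Finset.sum_range_succ]
    linarith [norm_sub_le (wronskian ψ φ (n - k)) ((z - E) * φ (n - k) * ψ (n - k))]

lemma HasBoundedSolutions.norm_cauchyData_le_right (h : HasBoundedSolutions V E K) {m n : ℤ}
    (hmn : m ≤ n) (hψ : ∀ i, m < i → i ≤ n → SolvesAt V z ψ i) :
    ‖cauchyData ψ m‖ ≤
      2 * K * Real.exp ((n - m : ℤ) * (‖z - E‖ * K)) * ‖cauchyData ψ n‖ := by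
  have hK : 0 ≤ K := zero_le_one.trans h.one_le
  obtain ⟨k, rfl⟩ : ∃ k : ℕ, m = n - k := ⟨(n - m).toNat, by omega⟩
  have hsum : ∀ l ≤ k, ‖cauchyData ψ (n - l)‖ ≤ 2 * K * ‖cauchyData ψ n‖ +
      ‖z - E‖ * K * ∑ s ∈ Finset.range l, ‖cauchyData ψ (n - s)‖ := fun l hl =>
    norm_cauchyData_le_of_wronskian fun φ hφ h1 =>
      norm_wronskian_sub_le (fun i hi => hψ i (by omega)) hφ fun i =>
        (h φ hφ _ i).trans (mul_le_of_le_one_right hK h1)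
  refine (le_mul_exp_of_le_add_sum (u := fun l : ℕ => ‖cauchyData ψ (n - l)‖) (by positivity)
    (by positivity) hsum).trans (le_of_eq ?_)
  rw [sub_sub_cancel, Int.cast_natCast]
  ring

lemma HasBoundedSolutions.norm_cauchyData_le_left (h : HasBoundedSolutions V E K) {m n : ℤ}
    (hnm : n ≤ m) (hψ : ∀ i, n < i → i ≤ m → SolvesAt V z ψ i) :
    ‖cauchyData ψ m‖ ≤
      2 * K * Real.exp ((m - n : ℤ) * (‖z - E‖ * K)) * ‖cauchyData ψ n‖ := by
  have hrefl : ∀ i, -(-i - 1) - 1 = i := fun i : ℤ => by ring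
  have hright := h.comp_neg.norm_cauchyData_le_right (z := z) (ψ := fun j => ψ (-j))
    (m := -m - 1) (n := -n - 1) (by omega)
    fun i h1 h2 => (hψ (-i) (by omega) (by omega)).comp_neg
  rwa [norm_cauchyData_comp_neg, norm_cauchyData_comp_neg, hrefl, hrefl,
    show -n - 1 - (-m - 1) = m - n by ring] at hright

end Solutions

end DiscreteSchrodinger

namespace ThueMorse

open DiscreteSchrodinger

lemma substWord_cons (a : Fin 2) (w : List (Fin 2)) :
    substWord (a :: w) = a :: (1 - a) :: substWord w := by
  have h : substLetter a = [a, 1 - a] := by revert a; decide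
  simp only [substWord, List.flatMap_cons, h, List.cons_append, List.nil_append]

lemma getElem?_substWord_two_mul (w : List (Fin 2)) (i : ℕ) :
    (substWord w)[2 * i]? = w[i]? := by
  induction w generalizing i with
  | nil => rfl
  | cons a w ih => cases i <;> simp [substWord_cons, mul_add, ih]

lemma getElem?_substWord_two_mul_add_one (w : List (Fin 2)) (i : ℕ) :
    (substWord w)[2 * i + 1]? = w[i]?.map (1 - ·) := by
  induction w generalizing i with
  | nil => rfl
  | cons a w ih => cases i <;> simp [substWord_cons, mul_add, ih]

lemma getElem?_word {k n : ℕ} (h : n < 2 ^ k) : (word k)[n]? = some (u n) := by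
  have hn : n < (word k).length := by rwa [length_word]
  rw [List.getElem?_eq_getElem hn, word_getElem_eq_u]

lemma u_two_mul (n : ℕ) : u (2 * n) = u n := by
  have hn : n < 2 ^ n := Nat.lt_two_pow_self
  have h := getElem?_substWord_two_mul (word n) n
  rw [← word_succ, getElem?_word (by rw [pow_succ]; omega), getElem?_word hn] at h
  exact Option.some.inj h

lemma u_two_mul_add_one (n : ℕ) : u (2 * n + 1) = 1 - u n := by
  have hn : n < 2 ^ n := Nat.lt_two_pow_self
  have h := getElem?_substWord_two_mul_add_one (word n) n
  rw [← word_succ, getElem?_word (by rw [pow_succ]; omega), getElem?_word hn] at h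
  exact Option.some.inj h

lemma u_block (k : ℕ) :
    u (8 * k) = u k ∧ u (8 * k + 1) = 1 - u k ∧ u (8 * k + 2) = 1 - u k ∧ u (8 * k + 3) = u k ∧
    u (8 * k + 4) = 1 - u k ∧ u (8 * k + 5) = u k ∧ u (8 * k + 6) = u k ∧
    u (8 * k + 7) = 1 - u k := by
  rw [show 8 * k = 2 * (2 * (2 * k)) by ring,
    show 2 * (2 * (2 * k)) + 2 = 2 * (2 * (2 * k) + 1) by ring,
    show 2 * (2 * (2 * k)) + 3 = 2 * (2 * (2 * k) + 1) + 1 by ring,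
    show 2 * (2 * (2 * k)) + 4 = 2 * (2 * (2 * k + 1)) by ring,
    show 2 * (2 * (2 * k)) + 5 = 2 * (2 * (2 * k + 1)) + 1 by ring,
    show 2 * (2 * (2 * k)) + 6 = 2 * (2 * (2 * k + 1) + 1) by ring,
    show 2 * (2 * (2 * k)) + 7 = 2 * (2 * (2 * k + 1) + 1) + 1 by ring]
  simp only [u_two_mul, u_two_mul_add_one, sub_sub_cancel, and_self]

lemma transferProd_u_eight_mul {R : Type*} [CommRing R] {q : Fin 2 → R} (hq : q 0 * q 1 = 2)
    (k : ℕ) (v : R × R) : transferProd (fun n => q (u n)) (8 * k) v = v := by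
  have hpair : ∀ e, q e * q (1 - e) = 2 := Fin.forall_fin_two.2 ⟨hq, (mul_comm _ _).trans hq⟩
  induction k with
  | zero => rfl
  | succ k ih =>
    obtain ⟨h0, h1, h2, h3, h4, h5, h6, h7⟩ := u_block k
    rw [show 8 * (k + 1) = 8 * k + 7 + 1 by ring]
    simp only [transferProd_succ_apply, h0, h1, h2, h3, h4, h5, h6, h7, ih,
      transfer_block (hpair (u k))]

/-- The coefficient `E - V n` of the recursion for solutions at energy `E`, at a site `n` that
carries the letter `e`. -/
def coeff (E lam : ℝ) (e : Fin 2) : ℂ :=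
  (E - lam * ((e : ℕ) : ℝ) : ℝ)

lemma norm_coeff_le (E lam : ℝ) (e : Fin 2) : ‖coeff E lam e‖ ≤ |E| + |lam| := by
  rw [coeff, Complex.norm_real, Real.norm_eq_abs]
  fin_cases e
  · simp
  · simpa using abs_sub E lam

lemma exists_cauchyData_eq_transferProd {lam E : ℝ} {ω : ℤ → Fin 2} (hω : ω ∈ subshift)
    {φ : ℤ → ℂ} (hφ : ∀ i, SolvesAt (potential lam ω) E φ i) (m : ℤ) (l : ℕ) :
    ∃ j v, cauchyData φ m = transferProd (fun n => coeff E lam (u n)) j v ∧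
      cauchyData φ (m + l) = transferProd (fun n => coeff E lam (u n)) (j + l) v := by
  obtain ⟨j, hj⟩ := hω (m + 1) l
  have hstep := eq_transferProd_of_step (q := fun n => coeff E lam (u n)) (j := j) (l := l)
    (w := fun i => cauchyData φ (m + i)) fun i hi => by
      have h := solvesAt_add_one_iff.1 (hφ (m + i + 1))
      rw [potential, show m + (i : ℤ) + 1 = m + 1 + i by ring, hj i hi] at h
      rw [Nat.cast_succ, ← add_assoc, add_right_comm]
      simpa [coeff] using h
  rw [Nat.cast_zero, add_zero] at hstep
  exact ⟨j, _, (LinearEquiv.apply_symm_apply _ _).symm, hstep⟩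

lemma hasBoundedSolutions_potential {lam E : ℝ} {ω : ℤ → Fin 2} (hω : ω ∈ subshift)
    (hE : E * (E - lam) = 2) :
    HasBoundedSolutions (potential lam ω) E ((|E| + |lam| + 1) ^ 8 * (|E| + |lam| + 1) ^ 8) := by
  have hq : coeff E lam 0 * coeff E lam 1 = 2 := by
    simpa [coeff] using congrArg Complex.ofReal hE
  have hL : ∀ i, ‖coeff E lam (u i)‖ + 1 ≤ |E| + |lam| + 1 := fun i =>
    add_le_add_left (norm_coeff_le E lam (u i)) 1
  have hbound := norm_transferProd_le_of_periodic hL (by norm_num) (transferProd_u_eight_mul hq)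
  intro φ hφ m n
  rcases le_total m n with hmn | hnm
  · obtain ⟨l, rfl⟩ := Int.le.dest hmn
    obtain ⟨j, v, hm, hn⟩ := exists_cauchyData_eq_transferProd hω hφ m l
    rw [hm, hn]
    exact hbound _ _ v
  · obtain ⟨l, rfl⟩ := Int.le.dest hnm
    obtain ⟨j, v, hn, hm⟩ := exists_cauchyData_eq_transferProd hω hφ n l
    rw [hm, hn]
    exact hbound _ _ v

lemma exists_energy (lam : ℝ) : ∃ E : ℝ, E * (E - lam) = 2 := by
  refine ⟨(lam + √(lam ^ 2 + 8)) / 2, ?_⟩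
  linear_combination Real.sq_sqrt (show 0 ≤ lam ^ 2 + 8 by positivity) / 4

end ThueMorse

namespace DiscreteSchrodinger

open MeasureTheory Filter Topology Complex

section Evolution

lemma inner_shift (k : ℤ) (x y : H2) : inner ℂ (shift k x) y = inner ℂ x (shift (-k) y) := by
  rw [lp.inner_eq_tsum, lp.inner_eq_tsum,
    ← (Equiv.addRight k).tsum_eq fun n : ℤ => inner ℂ (x n) (shift (-k) y n)]
  refine tsum_congr fun n => ?_
  change inner ℂ (x (n + k)) (y n) = inner ℂ (x (n + k)) (y (n + k + -k))
  rw [add_neg_cancel_right]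

variable {V : ℤ → ℝ} (hV : BddAbove (Set.range fun n => |V n|))

lemma inner_mulPotential (x y : H2) :
    inner ℂ (mulPotential V hV x) y = inner ℂ x (mulPotential V hV y) := by
  rw [lp.inner_eq_tsum, lp.inner_eq_tsum]
  refine tsum_congr fun n => ?_
  change inner ℂ ((V n : ℂ) * x n) (y n) = inner ℂ (x n) ((V n : ℂ) * y n)
  simp only [RCLike.inner_apply, map_mul, conj_ofReal]
  ring

lemma isSelfAdjoint_hamiltonian : IsSelfAdjoint (hamiltonian V hV) := by
  rw [ContinuousLinearMap.isSelfAdjoint_iff_isSymmetric]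
  intro x y
  change inner ℂ (shift (-1) x + shift 1 x + mulPotential V hV x) y =
    inner ℂ x (shift (-1) y + shift 1 y + mulPotential V hV y)
  simp only [inner_add_left, inner_add_right, inner_shift, inner_mulPotential, neg_neg]
  ring

variable {H : H2 →L[ℂ] H2} {z : ℂ}

lemma evolve_zero (H : H2 →L[ℂ] H2) (ψ : H2) : evolve H 0 ψ = ψ := by
  simp [evolve]

lemma norm_evolve (hH : IsSelfAdjoint H) (t : ℝ) (ψ : H2) : ‖evolve H t ψ‖ = ‖ψ‖ := by
  have hself : IsSelfAdjoint ((-t : ℂ) • H) := IsSelfAdjoint.smul (by simp [IsSelfAdjoint]) hH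
  have hunitary := (selfAdjoint.expUnitary ⟨(-t : ℂ) • H, selfAdjoint.mem_iff.2 hself⟩).2
  rw [selfAdjoint.expUnitary_coe, smul_smul, mul_neg] at hunitary
  exact ContinuousLinearMap.norm_map_of_mem_unitary hunitary ψ

lemma hasDerivAt_evolve (H : H2 →L[ℂ] H2) (t : ℝ) (ψ : H2) :
    HasDerivAt (fun s : ℝ => evolve H s ψ) (-I • H (evolve H t ψ)) t := by
  have hexp := hasDerivAt_exp_smul_const' (𝕂 := ℂ) H (-(I * (t : ℂ)))
  have htime : HasDerivAt (fun s : ℝ => -(I * (s : ℂ))) (-I) t := by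
    simpa using ((ofRealCLM.hasDerivAt (x := t)).const_mul I).fun_neg
  exact ((ContinuousLinearMap.apply ℂ H2 ψ).restrictScalars ℝ).hasFDerivAt.comp_hasDerivAt t
    (hexp.scomp t htime)

lemma continuous_evolve (H : H2 →L[ℂ] H2) (ψ : H2) : Continuous fun t : ℝ => evolve H t ψ :=
  continuous_iff_continuousAt.2 fun t => (hasDerivAt_evolve H t ψ).continuousAt

lemma hasDerivAt_cexp_smul_evolve (H : H2 →L[ℂ] H2) (z : ℂ) (t : ℝ) (ψ : H2) :
    HasDerivAt (fun s : ℝ => cexp (I * z * s) • evolve H s ψ)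
      ((I • (z • ContinuousLinearMap.id ℂ H2 - H)) (cexp (I * z * t) • evolve H t ψ)) t := by
  have hphase : HasDerivAt (fun s : ℝ => cexp (I * z * s)) (cexp (I * z * t) * (I * z)) t := by
    simpa using ((ofRealCLM.hasDerivAt (x := t)).const_mul (I * z)).cexp
  refine (hphase.smul (hasDerivAt_evolve H t ψ)).congr_deriv ?_
  simp only [smul_apply, sub_apply, map_smul,
    ContinuousLinearMap.id_apply]
  module

lemma norm_cexp_mul (z : ℂ) (t : ℝ) : ‖cexp (I * z * t)‖ = Real.exp (-z.im * t) := by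
  simp [norm_exp]

lemma norm_cexp_smul_evolve (hH : IsSelfAdjoint H) (z : ℂ) (t : ℝ) (ψ : H2) :
    ‖cexp (I * z * t) • evolve H t ψ‖ = Real.exp (-z.im * t) * ‖ψ‖ := by
  rw [norm_smul, norm_evolve hH, norm_cexp_mul]

lemma integrableOn_cexp_smul_evolve (hH : IsSelfAdjoint H) (hz : 0 < z.im) (ψ : H2) :
    IntegrableOn (fun t : ℝ => cexp (I * z * t) • evolve H t ψ) (Set.Ioi 0) := by
  have hphase : Continuous fun t : ℝ => cexp (I * z * t) := by fun_prop
  refine Integrable.mono' ((integrableOn_exp_mul_Ioi (neg_lt_zero.2 hz) 0).mul_const ‖ψ‖)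
    (hphase.smul (continuous_evolve H ψ)).aestronglyMeasurable (Eventually.of_forall fun t => ?_)
  exact (norm_cexp_smul_evolve hH z t ψ).le

lemma tendsto_cexp_smul_evolve (hH : IsSelfAdjoint H) (hz : 0 < z.im) (ψ : H2) :
    Tendsto (fun t : ℝ => cexp (I * z * t) • evolve H t ψ) atTop (𝓝 0) := by
  rw [tendsto_zero_iff_norm_tendsto_zero]
  simp only [norm_cexp_smul_evolve hH]
  have hexp : Tendsto (fun t => Real.exp (-z.im * t)) atTop (𝓝 0) :=
    Real.tendsto_exp_atBot.comp (tendsto_id.const_mul_atTop_of_neg (neg_lt_zero.2 hz))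
  simpa using hexp.mul_const ‖ψ‖

/-- The resolvent `(H - z)⁻¹ ψ` for `0 < z.im`, written as the Laplace transform of the
evolution. -/
noncomputable def laplaceEvolve (H : H2 →L[ℂ] H2) (z : ℂ) (ψ : H2) : H2 :=
  I • ∫ t in Set.Ioi (0 : ℝ), cexp (I * z * t) • evolve H t ψ

lemma apply_laplaceEvolve (hH : IsSelfAdjoint H) (hz : 0 < z.im) (ψ : H2) :
    H (laplaceEvolve H z ψ) = z • laplaceEvolve H z ψ + ψ := by
  set A := I • (z • ContinuousLinearMap.id ℂ H2 - H)
  have hint := integrableOn_cexp_smul_evolve hH hz ψ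
  have hFTC : ∫ t in Set.Ioi (0 : ℝ), A (cexp (I * z * t) • evolve H t ψ) = -ψ := by
    rw [integral_Ioi_of_hasDerivAt_of_tendsto'
      (fun t _ => hasDerivAt_cexp_smul_evolve H z t ψ) (A.integrable_comp hint)
      (tendsto_cexp_smul_evolve hH hz ψ)]
    simp [evolve_zero]
  rw [A.integral_comp_comm hint] at hFTC
  have hresolvent : z • laplaceEvolve H z ψ - H (laplaceEvolve H z ψ) = -ψ := by
    rw [← hFTC, laplaceEvolve, map_smul, smul_comm z I, ← smul_sub]
    rfl
  rw [sub_eq_iff_eq_add.1 hresolvent]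
  abel

lemma enorm_laplaceEvolve_apply_le (hH : IsSelfAdjoint H) (hz : 0 < z.im) (ψ : H2) (n : ℤ) :
    ‖laplaceEvolve H z ψ n‖ₑ ≤
      ∫⁻ t in Set.Ioi (0 : ℝ), ENNReal.ofReal (Real.exp (-z.im * t)) * ‖evolve H t ψ n‖ₑ := by
  have hcomm := (lp.evalCLM ℂ (fun _ : ℤ => ℂ) 2 n).integral_comp_comm
    (integrableOn_cexp_smul_evolve hH hz ψ)
  have hphase : ∀ t : ℝ, ‖cexp (I * z * t)‖ₑ = ENNReal.ofReal (Real.exp (-z.im * t)) := fun t => by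
    rw [← ofReal_norm, norm_cexp_mul]
  calc ‖laplaceEvolve H z ψ n‖ₑ
      = ‖I * ∫ t in Set.Ioi (0 : ℝ), cexp (I * z * t) * evolve H t ψ n‖ₑ :=
        congrArg (fun w => ‖I * w‖ₑ) hcomm.symm
    _ ≤ ∫⁻ t in Set.Ioi (0 : ℝ), ‖cexp (I * z * t) * evolve H t ψ n‖ₑ := by
        rw [enorm_mul, ← ofReal_norm I, norm_I, ENNReal.ofReal_one, one_mul]
        exact enorm_integral_le_lintegral_enorm _
    _ = ∫⁻ t in Set.Ioi (0 : ℝ), ENNReal.ofReal (Real.exp (-z.im * t)) * ‖evolve H t ψ n‖ₑ := by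
        simp only [enorm_mul, hphase]

lemma lintegral_exp_neg_mul_Ioi {a : ℝ} (ha : 0 < a) :
    ∫⁻ t in Set.Ioi (0 : ℝ), ENNReal.ofReal (Real.exp (-a * t)) = ENNReal.ofReal (1 / a) := by
  rw [← ofReal_integral_eq_lintegral_ofReal (integrableOn_exp_mul_Ioi (neg_lt_zero.2 ha) 0)
    (Eventually.of_forall fun t => (Real.exp_pos _).le), integral_exp_mul_Ioi (neg_lt_zero.2 ha)]
  simp

/-- The Green function `⟨δ_n, (H - z)⁻¹ δ_1⟩` for `0 < z.im`. -/
noncomputable def green (H : H2 →L[ℂ] H2) (z : ℂ) (n : ℤ) : ℂ :=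
  laplaceEvolve H z (delta 1) n

lemma sq_enorm_green_le (hH : IsSelfAdjoint H) (hz : 0 < z.im) (n : ℤ) :
    ‖green H z n‖ₑ ^ 2 ≤ ENNReal.ofReal (1 / z.im) *
      ∫⁻ t in Set.Ioi (0 : ℝ),
        ENNReal.ofReal (Real.exp (-z.im * t)) * ‖evolve H t (delta 1) n‖ₑ ^ 2 := by
  have hevolve : Continuous fun t : ℝ => evolve H t (delta 1) n :=
    (lp.evalCLM ℂ (fun _ : ℤ => ℂ) 2 n).continuous.comp (continuous_evolve H (delta 1))
  rw [← lintegral_exp_neg_mul_Ioi hz]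
  exact (pow_le_pow_left' (enorm_laplaceEvolve_apply_le hH hz (delta 1) n) 2).trans
    (sq_lintegral_mul_le (by fun_prop) hevolve.enorm.measurable.aemeasurable)

lemma ofReal_sq_norm_green_le_timeAvgProb (hH : IsSelfAdjoint H) {T : ℝ} (hT : 0 < T)
    (hz : z.im = 2 / T) (n : ℤ) :
    ENNReal.ofReal (2 * (‖green H z n‖ / T) ^ 2) ≤ timeAvgProb H n T := by
  have hweight : ∀ t : ℝ, ENNReal.ofReal (Real.exp (-2 * t / T) * ‖evolve H t (delta 1) n‖ ^ 2) =
      ENNReal.ofReal (Real.exp (-z.im * t)) * ‖evolve H t (delta 1) n‖ₑ ^ 2 := fun t => by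
    rw [ENNReal.ofReal_mul (Real.exp_pos _).le, ENNReal.ofReal_pow (norm_nonneg _), ofReal_norm,
      hz, show -2 * t / T = -(2 / T) * t by ring]
  have hz0 : 0 < z.im := by rw [hz]; positivity
  have hgreen := sq_enorm_green_le hH hz0 n
  simp only [← hweight] at hgreen
  calc ENNReal.ofReal (2 * (‖green H z n‖ / T) ^ 2)
      = ENNReal.ofReal (2 / T ^ 2) * ‖green H z n‖ₑ ^ 2 := by
        rw [← ofReal_norm, ← ENNReal.ofReal_pow (norm_nonneg _),
          ← ENNReal.ofReal_mul (by positivity)]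
        congr 1
        ring
    _ ≤ ENNReal.ofReal (2 / T ^ 2) * (ENNReal.ofReal (1 / z.im) * _) := by gcongr
    _ = timeAvgProb H n T := by
        rw [timeAvgProb, ← mul_assoc, ← ENNReal.ofReal_mul (by positivity), hz]
        congr 2
        field_simp

end Evolution

section Moment

variable {H : H2 →L[ℂ] H2} {z : ℂ} {T : ℝ}

lemma sq_norm_cauchyData_le (ψ : ℤ → ℂ) (n : ℤ) :
    ‖cauchyData ψ n‖ ^ 2 ≤ ‖ψ n‖ ^ 2 + ‖ψ (n + 1)‖ ^ 2 := by
  rcases max_choice ‖ψ n‖ ‖ψ (n + 1)‖ with h | h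
  · rw [show ‖cauchyData ψ n‖ = ‖ψ n‖ from h]
    exact le_add_of_nonneg_right (sq_nonneg _)
  · rw [show ‖cauchyData ψ n‖ = ‖ψ (n + 1)‖ from h]
    exact le_add_of_nonneg_left (sq_nonneg _)

lemma ofReal_sq_norm_cauchyData_green_le (hH : IsSelfAdjoint H) (hT : 0 < T) (hz : z.im = 2 / T)
    (n : ℤ) : ENNReal.ofReal (2 * (‖cauchyData (green H z) n‖ / T) ^ 2) ≤
      timeAvgProb H n T + timeAvgProb H (n + 1) T := by
  refine le_trans ?_ (add_le_add (ofReal_sq_norm_green_le_timeAvgProb hH hT hz n)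
    (ofReal_sq_norm_green_le_timeAvgProb hH hT hz (n + 1)))
  rw [← ENNReal.ofReal_add (by positivity) (by positivity)]
  refine ENNReal.ofReal_le_ofReal ?_
  simp only [div_pow, ← mul_add, ← add_div]
  gcongr
  exact sq_norm_cauchyData_le _ n

lemma card_mul_le_moment (hH : IsSelfAdjoint H) (hT : 0 < T) (hz : z.im = 2 / T) {p R c : ℝ}
    (hp : 0 ≤ p) (hR : 0 ≤ R) (hc : 0 ≤ c) {S : Finset ℤ}
    (hS : ∀ n ∈ S, R + 1 ≤ |(n : ℝ)| ∧ c ≤ ‖cauchyData (green H z) n‖) :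
    ENNReal.ofReal (S.card * (R ^ p * (c / T) ^ 2)) ≤ moment H p T := by
  set F : ℤ → ℝ≥0∞ := fun n => ENNReal.ofReal (|(n : ℝ)| ^ p) * timeAvgProb H n T
  have hpair : ∀ n ∈ S, 2 * ENNReal.ofReal (R ^ p * (c / T) ^ 2) ≤ F n + F (n + 1) := by
    intro n hn
    obtain ⟨hdist, hdata⟩ := hS n hn
    have hdist' : R ≤ |((n + 1 : ℤ) : ℝ)| := by
      have hsucc := abs_sub ((n + 1 : ℤ) : ℝ) 1
      rw [Int.cast_add, Int.cast_one, add_sub_cancel_right, abs_one] at hsucc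
      rw [Int.cast_add, Int.cast_one]
      linarith
    calc 2 * ENNReal.ofReal (R ^ p * (c / T) ^ 2)
        = ENNReal.ofReal (R ^ p) * ENNReal.ofReal (2 * (c / T) ^ 2) := by
          rw [← ENNReal.ofReal_ofNat, ← ENNReal.ofReal_mul (by norm_num),
            ← ENNReal.ofReal_mul (by positivity), mul_left_comm]
      _ ≤ ENNReal.ofReal (R ^ p) *
            ENNReal.ofReal (2 * (‖cauchyData (green H z) n‖ / T) ^ 2) := by gcongr
      _ ≤ ENNReal.ofReal (R ^ p) * (timeAvgProb H n T + timeAvgProb H (n + 1) T) := by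
          gcongr
          exact ofReal_sq_norm_cauchyData_green_le hH hT hz n
      _ ≤ F n + F (n + 1) := by
          rw [mul_add]
          dsimp only [F]
          gcongr
          linarith
  have hdouble : 2 * ENNReal.ofReal (S.card * (R ^ p * (c / T) ^ 2)) ≤ 2 * moment H p T :=
    calc 2 * ENNReal.ofReal (S.card * (R ^ p * (c / T) ^ 2))
        = ∑ _n ∈ S, 2 * ENNReal.ofReal (R ^ p * (c / T) ^ 2) := by
          rw [Finset.sum_const, nsmul_eq_mul, ENNReal.ofReal_mul (Nat.cast_nonneg _),
            ENNReal.ofReal_natCast, mul_left_comm]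
      _ ≤ ∑ n ∈ S, (F n + F (n + 1)) := Finset.sum_le_sum hpair
      _ ≤ 2 * moment H p T := sum_add_shift_le_two_mul_tsum F 1 S
  exact (ENNReal.mul_le_mul_iff_right two_ne_zero ENNReal.ofNat_ne_top).1 hdouble

lemma le_betaMinus {p q C : ℝ} (hC : 0 < C)
    (h : ∀ᶠ T in atTop, ENNReal.ofReal (C * T ^ q) ≤ moment H p T) :
    (q : EReal) ≤ betaMinus H p := by
  have hlim : Tendsto (fun T : ℝ => ((Real.log C / Real.log T + q : ℝ) : EReal)) atTop
      (𝓝 (q : EReal)) := by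
    refine (continuous_coe_real_ereal.tendsto q).comp ?_
    simpa using (Real.tendsto_log_atTop.const_div_atTop (Real.log C)).add_const q
  rw [← hlim.liminf_eq]
  refine liminf_le_liminf ?_
  filter_upwards [h, eventually_gt_atTop 1] with T hT hT1
  have hT0 : 0 < T := by linarith
  have hlog : 0 < Real.log T := Real.log_pos hT1
  calc ((Real.log C / Real.log T + q : ℝ) : EReal)
      = ENNReal.log (ENNReal.ofReal (C * T ^ q)) / ((Real.log T : ℝ) : EReal) := by
        rw [ENNReal.log_ofReal_of_pos (by positivity), ← EReal.coe_div,
          Real.log_mul hC.ne' (by positivity), Real.log_rpow hT0, add_div,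
          mul_div_cancel_right₀ _ hlog.ne']
    _ ≤ ENNReal.log (moment H p T) / ((Real.log T : ℝ) : EReal) :=
        EReal.div_le_div_right_of_nonneg (by exact_mod_cast hlog.le) (ENNReal.log_monotone hT)

end Moment

section BoundedSolutions

variable {V : ℤ → ℝ} (hV : BddAbove (Set.range fun n => |V n|)) {z : ℂ}

lemma green_recursion (hz : 0 < z.im) (n : ℤ) :
    green (hamiltonian V hV) z (n + 1) + green (hamiltonian V hV) z (n - 1) +
      V n * green (hamiltonian V hV) z n =
      z * green (hamiltonian V hV) z n + delta 1 n := by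
  have happly := congrArg (fun ψ : H2 => ψ n)
    (apply_laplaceEvolve (isSelfAdjoint_hamiltonian hV) hz (delta 1))
  rw [add_comm (green _ _ (n + 1))]
  exact happly

lemma solvesAt_green (hz : 0 < z.im) {n : ℤ} (hn : n ≠ 1) :
    SolvesAt V z (green (hamiltonian V hV) z) n := by
  have hdelta : delta 1 n = 0 := by simp [delta, hn]
  rw [SolvesAt, green_recursion hV hz, hdelta, add_zero]

lemma one_le_mul_max_norm_cauchyData_green (hz : 0 < z.im) :
    1 ≤ (‖z‖ + |V 1| + 2) * max ‖cauchyData (green (hamiltonian V hV) z) 0‖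
      ‖cauchyData (green (hamiltonian V hV) z) 1‖ := by
  have hsource := green_recursion hV hz 1
  set G := green (hamiltonian V hV) z
  set B := max ‖cauchyData G 0‖ ‖cauchyData G 1‖
  have hdelta : delta 1 1 = 1 := by simp [delta]
  have h0 : ‖G 0‖ ≤ B := (norm_fst_le (cauchyData G 0)).trans (le_max_left _ _)
  have h1 : ‖G 1‖ ≤ B := (norm_fst_le (cauchyData G 1)).trans (le_max_right _ _)
  have h2 : ‖G 2‖ ≤ B := (norm_snd_le (cauchyData G 1)).trans (le_max_right _ _)
  rw [one_add_one_eq_two, sub_self] at hsource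
  calc (1 : ℝ) = ‖G 2 + G 0 + (V 1 * G 1 - z * G 1)‖ := by
        rw [← norm_one (α := ℂ), ← hdelta]
        congr 1
        linear_combination -hsource
    _ ≤ ‖G 2‖ + ‖G 0‖ + (|V 1| * ‖G 1‖ + ‖z‖ * ‖G 1‖) := by
        refine (norm_add_le _ _).trans (add_le_add (norm_add_le _ _) ((norm_sub_le _ _).trans ?_))
        rw [norm_mul, norm_mul, norm_real, Real.norm_eq_abs]
    _ ≤ B + B + (|V 1| * B + ‖z‖ * B) := by gcongr
    _ = (‖z‖ + |V 1| + 2) * B := by ring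

variable {E : ℂ} {K : ℝ}

lemma HasBoundedSolutions.one_le_norm_cauchyData_green (h : HasBoundedSolutions V E K)
    (hz : 0 < z.im) (D : ℝ) :
    (∀ n : ℤ, 1 ≤ n → |(n : ℝ)| * ‖z - E‖ ≤ D →
      1 ≤ (‖z‖ + |V 1| + 2) * (2 * K * Real.exp (D * K)) *
        ‖cauchyData (green (hamiltonian V hV) z) n‖) ∨
    (∀ n : ℤ, n ≤ 0 → |(n : ℝ)| * ‖z - E‖ ≤ D →
      1 ≤ (‖z‖ + |V 1| + 2) * (2 * K * Real.exp (D * K)) *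
        ‖cauchyData (green (hamiltonian V hV) z) n‖) := by
  have hK : 0 ≤ K := zero_le_one.trans h.one_le
  have hsource := one_le_mul_max_norm_cauchyData_green hV hz
  set G := green (hamiltonian V hV) z
  set A := ‖z‖ + |V 1| + 2
  have hpropagate : ∀ {m n : ℤ} {d : ℤ}, 1 ≤ A * ‖cauchyData G m‖ → |(n : ℝ)| * ‖z - E‖ ≤ D →
      (d : ℝ) ≤ |(n : ℝ)| →
      ‖cauchyData G m‖ ≤ 2 * K * Real.exp (d * (‖z - E‖ * K)) * ‖cauchyData G n‖ →
      1 ≤ A * (2 * K * Real.exp (D * K)) * ‖cauchyData G n‖ := by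
    intro m n d hm hn hd hcompare
    have hexp : d * (‖z - E‖ * K) ≤ D * K := by
      rw [← mul_assoc]
      gcongr
      exact (mul_le_mul_of_nonneg_right hd (norm_nonneg _)).trans hn
    calc 1 ≤ A * (2 * K * Real.exp (d * (‖z - E‖ * K)) * ‖cauchyData G n‖) := by
          refine hm.trans ?_
          gcongr
      _ ≤ A * (2 * K * Real.exp (D * K) * ‖cauchyData G n‖) := by gcongr
      _ = _ := by ring
  rcases max_choice ‖cauchyData G 0‖ ‖cauchyData G 1‖ with hmax | hmax <;> rw [hmax] at hsource
  · refine Or.inr fun n hn hnD => hpropagate hsource hnD ?_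
      (h.norm_cauchyData_le_left hn fun i _ hi => solvesAt_green hV hz (by omega))
    rw [Int.cast_sub, Int.cast_zero, zero_sub]
    exact neg_le_abs _
  · refine Or.inl fun n hn hnD => hpropagate hsource hnD ?_
      (h.norm_cauchyData_le_right hn fun i hi _ => solvesAt_green hV hz (by omega))
    rw [Int.cast_sub, Int.cast_one]
    linarith [le_abs_self (n : ℝ)]

lemma HasBoundedSolutions.exists_le_norm_cauchyData_green {E : ℝ}
    (h : HasBoundedSolutions V E K) :
    ∃ c > 0, ∀ T ≥ (2 : ℝ),
      (∀ n : ℤ, 1 ≤ n → |(n : ℝ)| ≤ T →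
        c ≤ ‖cauchyData (green (hamiltonian V hV) (E + (2 / T : ℝ) * I)) n‖) ∨
      (∀ n : ℤ, n ≤ 0 → |(n : ℝ)| ≤ T →
        c ≤ ‖cauchyData (green (hamiltonian V hV) (E + (2 / T : ℝ) * I)) n‖) := by
  have hK : 0 < K := zero_lt_one.trans_le h.one_le
  set C := (|E| + |V 1| + 3) * (2 * K * Real.exp (2 * K))
  have hC0 : 0 < C := by positivity
  refine ⟨1 / C, by positivity, fun T hT => ?_⟩
  set z : ℂ := E + (2 / T : ℝ) * I with hz
  have hT0 : 0 < T := by linarith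
  have hz0 : 0 < z.im := by simpa [hz] using hT0
  have hdist : ‖z - E‖ = 2 / T := by
    rw [hz, add_sub_cancel_left, norm_mul, norm_I, mul_one, norm_real, Real.norm_eq_abs,
      abs_of_pos (by positivity)]
  have hnorm : ‖z‖ ≤ |E| + 1 := by
    have htri := norm_le_norm_add_norm_sub' z E
    rw [hdist, norm_real, Real.norm_eq_abs] at htri
    linarith [(div_le_one hT0).2 hT]
  have hwithin : ∀ n : ℤ, |(n : ℝ)| ≤ T → |(n : ℝ)| * ‖z - E‖ ≤ 2 := fun n hn => by
    rw [hdist, mul_div_assoc', div_le_iff₀ hT0]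
    linarith
  have hbound : ∀ r : ℝ, 0 ≤ r →
      1 ≤ (‖z‖ + |V 1| + 2) * (2 * K * Real.exp (2 * K)) * r → 1 / C ≤ r := fun r hr h1 => by
    rw [div_le_iff₀' hC0]
    refine h1.trans (mul_le_mul_of_nonneg_right ?_ hr)
    exact mul_le_mul_of_nonneg_right (by linarith) (by positivity)
  exact (h.one_le_norm_cauchyData_green hV hz0 2).imp
    (fun hright n h1 hn => hbound _ (norm_nonneg _) (hright n h1 (hwithin n hn)))
    (fun hleft n h0 hn => hbound _ (norm_nonneg _) (hleft n h0 (hwithin n hn)))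

lemma exists_finset_int_between {T : ℝ} (hT : 4 ≤ T) :
    ∃ S : Finset ℤ, T / 4 ≤ S.card ∧ ∀ n ∈ S, T / 4 + 1 ≤ n ∧ n ≤ T := by
  refine ⟨Finset.Icc ⌈T / 4 + 1⌉ ⌊T⌋, ?_, fun n hn => ?_⟩
  · have hcard : ⌊T⌋ + 1 - ⌈T / 4 + 1⌉ ≤ ((Finset.Icc ⌈T / 4 + 1⌉ ⌊T⌋).card : ℤ) := by
      rw [Int.card_Icc]
      exact Int.self_le_toNat _
    have hcast : (⌊T⌋ : ℝ) + 1 - ⌈T / 4 + 1⌉ ≤ (Finset.Icc ⌈T / 4 + 1⌉ ⌊T⌋).card := by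
      exact_mod_cast hcard
    linarith [Int.lt_floor_add_one T, Int.ceil_lt_add_one (T / 4 + 1)]
  · rw [Finset.mem_Icc] at hn
    exact ⟨Int.ceil_le.1 hn.1, Int.le_floor.1 hn.2⟩

lemma HasBoundedSolutions.exists_finset_le_norm_cauchyData_green {E : ℝ}
    (h : HasBoundedSolutions V E K) :
    ∃ c > 0, ∀ T ≥ (4 : ℝ), ∃ S : Finset ℤ, T / 4 ≤ S.card ∧ ∀ n ∈ S, T / 4 + 1 ≤ |(n : ℝ)| ∧
      c ≤ ‖cauchyData (green (hamiltonian V hV) (E + (2 / T : ℝ) * I)) n‖ := by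
  obtain ⟨c, hc, hgreen⟩ := h.exists_le_norm_cauchyData_green hV
  refine ⟨c, hc, fun T hT => ?_⟩
  obtain ⟨S, hcard, hS⟩ := exists_finset_int_between hT
  have hpos : ∀ n ∈ S, (1 : ℤ) ≤ n := fun n hn => by
    have h1 : (1 : ℝ) ≤ n := by linarith [(hS n hn).1]
    exact_mod_cast h1
  have habs : ∀ n ∈ S, |(n : ℝ)| = n := fun n hn => abs_of_pos (by linarith [(hS n hn).1])
  rcases hgreen T (by linarith) with hright | hleft
  · refine ⟨S, hcard, fun n hn => ?_⟩
    rw [habs n hn]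
    exact ⟨(hS n hn).1, hright n (hpos n hn) ((habs n hn).trans_le (hS n hn).2)⟩
  · refine ⟨S.map (Equiv.neg ℤ).toEmbedding, by rwa [Finset.card_map],
      Finset.forall_mem_map.2 fun n hn => ?_⟩
    have hneg : |((-n : ℤ) : ℝ)| = n := by rw [Int.cast_neg, abs_neg, habs n hn]
    refine ⟨(hS n hn).1.trans_eq hneg.symm, hleft (-n) ?_ (hneg.trans_le (hS n hn).2)⟩
    linarith [hpos n hn]

theorem le_betaMinus_of_hasBoundedSolutions {E p : ℝ} (h : HasBoundedSolutions V E K)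
    (hp : 0 ≤ p) : ((p - 1 : ℝ) : EReal) ≤ betaMinus (hamiltonian V hV) p := by
  obtain ⟨c, hc, hgreen⟩ := h.exists_finset_le_norm_cauchyData_green hV
  refine le_betaMinus (C := 1 / 4 * (1 / 4) ^ p * c ^ 2) (by positivity) ?_
  filter_upwards [eventually_ge_atTop 4] with T hT
  have hT0 : 0 < T := by linarith
  obtain ⟨S, hcard, hS⟩ := hgreen T hT
  refine le_trans (ENNReal.ofReal_le_ofReal ?_)
    (card_mul_le_moment (isSelfAdjoint_hamiltonian hV) hT0 (by simp) hp (by positivity) hc.le hS)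
  calc 1 / 4 * (1 / 4) ^ p * c ^ 2 * T ^ (p - 1)
      = T / 4 * ((T / 4) ^ p * (c / T) ^ 2) := by
        rw [Real.rpow_sub_one hT0.ne', div_eq_mul_one_div T 4, Real.mul_rpow hT0.le (by norm_num)]
        field_simp
    _ ≤ S.card * ((T / 4) ^ p * (c / T) ^ 2) := by gcongr

end BoundedSolutions

end DiscreteSchrodinger

theorem theorem4 (lam : ℝ) (ω : ℤ → Fin 2) (hω : ω ∈ ThueMorse.subshift) (p : ℝ) (hp : 0 < p) :
    ((p - 1 : ℝ) : EReal) ≤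
      DiscreteSchrodinger.betaMinus
        (DiscreteSchrodinger.hamiltonian (ThueMorse.potential lam ω)
          (ThueMorse.bddAbove_potential lam ω)) p := by
  obtain ⟨E, hE⟩ := ThueMorse.exists_energy lam
  exact DiscreteSchrodinger.le_betaMinus_of_hasBoundedSolutions _
    (ThueMorse.hasBoundedSolutions_potential hω hE) hp.le
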